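/- **Setting.** Let $(M,d)$ be a metric space and $k\ge 1$. An online $k$-server algorithm $A$ starts with its servers at $s_1(0),\dots,s_k(0)\in M$. After each request $\sigma_t\in M$ it chooses a new configuration $(s_1(t),\dots,s_k(t))$ with some server at $\sigma_t$, depending only on the initial configuration and $\sigma_1,\dots,\sigma_t$ (moving only one server per request is allowed but not required). Server $i$ pays $d(s_i(t-1),s_i(t))$ at time $t$, and $\mathrm{cost}(A,\sigma)$ is the sum of these payments over all servers and all requests of $\sigma=(\sigma_1,\dots,\sigma_T)$. Let $\mathrm{diam}=\max_{0\le t\le T}\max_{i,j}d(s_i(t),s_j(t))$ be the largest separation of two servers of $A$ during the execution; it is at most the diameter of $M$ whenever that is finite. *Phased random swapping* with input $A$ and parameter $\gamma>0$ runs $A$ in phases $\ell=1,2,\dots$; phase $\ell$ has budget $\phi_\ell=\ell^\gamma$. At the start of each phase (including the first, before any request) a uniformly random permutation $\pi_\ell$ of the servers is drawn, independently of all earlier ones; each server $i$ moves to the current position of server $\pi_\ell(i)$ and takes over its role in $A$. Requests are then served as $A$ serves them, each server moving as the server of $A$ whose role it plays. As soon as the cost of $A$ accumulated in the current phase is at least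 $\phi_\ell$, the phase ends and phase $\ell+1$ begins with accumulated cost $0$. The cost $c_i$ of server $i$ is the total distance it moves, swaps included. **Theorem.** There is an absolute constant $C>0$, and for every $\gamma_0>0$ there is a constant $c>0$ depending only on $\gamma_0$, such that the following holds for every $\gamma\ge\gamma_0$, every $k\ge1$, every metric space, every initial configuration, every online $k$-server algorithm $A$ and every finite request sequence $\sigma$ such that $\mathrm{cost}(A,\sigma)\ge 1$ or all servers start at the same point. 1. For every $\varepsilon>0$, with probability at least $$1-k\cdot\exp\left(-c\,\frac{\min(\varepsilon,\varepsilon^2)}{\gamma k}\,\mathrm{cost}(A,\sigma)^{1/(\gamma+1)}\right),$$ every server $i$ satisfies $$c_i\le(1+\varepsilon)\frac{\mathrm{cost}(A,\sigma)}{k}+C\cdot\mathrm{cost}(A,\sigma)^{1/(\gamma+1)}\cdot\mathrm{diam}.$$ 2. For every outcome of the random permutations, $$\sum_{i=1}^k c_i\le\mathrm{cost}(A,\sigma)+C\cdot k\cdot\mathrm{cost}(A,\sigma)^{1/(\gamma+1)}\cdot\mathrm{diam}.$$ -/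

import Mathlib

open MeasureTheory ProbabilityTheory

namespace KServer

/-- A deterministic online `k`-server algorithm on `M`.  From the initial configuration, the list of
past requests (oldest first) and the current request it computes the next configuration; some server
must be located at the current request.  Moving a single server is the special case in which only one
coordinate of the configuration changes. -/
structure OnlineAlgorithm (k : ℕ) (M : Type*) where
  next : (Fin k → M) → List M → M → (Fin k → M)
  serves : ∀ s₀ past r, ∃ i, next s₀ past r i = r

/-- The family `π 0, π 1, π 2, …` of random permutations of the servers is independent, and each
member is uniformly distributed. -/
structure IsUniformPermSeq {k : ℕ} {Ω : Type*} [MeasurableSpace Ω] (P : Measure Ω)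
    (π : ℕ → Ω → Equiv.Perm (Fin k)) : Prop where
  measurableSet_eq : ∀ l g, MeasurableSet {ω | π l ω = g}
  prob_eq : ∀ l g, P {ω | π l ω = g} = ((k.factorial : ℕ) : ENNReal)⁻¹
  indep : iIndepFun (m := fun _ => ⊤) π P

noncomputable section

section Base

variable {k : ℕ} {M : Type*} [MetricSpace M]

/-- `A.config s₀ σ t` : the positions of the servers of `A` after the first `t` requests
`σ 0, …, σ (t - 1)`, when they start in `s₀`. -/
def OnlineAlgorithm.config (A : OnlineAlgorithm k M) (s₀ : Fin k → M) (σ : ℕ → M) :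
    ℕ → Fin k → M
  | 0 => s₀
  | t + 1 => A.next s₀ ((List.range t).map σ) (σ t)

/-- The distance that server `i` of `A` moves to serve the request `σ t`. -/
def OnlineAlgorithm.moveCost (A : OnlineAlgorithm k M) (s₀ : Fin k → M) (σ : ℕ → M)
    (t : ℕ) (i : Fin k) : ℝ :=
  dist (A.config s₀ σ t i) (A.config s₀ σ (t + 1) i)

/-- The total cost of `A` on the first `T` requests. -/
def OnlineAlgorithm.cost (A : OnlineAlgorithm k M) (s₀ : Fin k → M) (σ : ℕ → M) (T : ℕ) : ℝ :=
  ∑ i, ∑ t ∈ Finset.range T, A.moveCost s₀ σ t i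

/-- The maximum distance between two servers at any of the times `0, …, T` (for `0 < k` a maximum
over a finite nonempty set). It is at most the diameter of `M` when `M` is bounded. -/
def OnlineAlgorithm.diam (A : OnlineAlgorithm k M) (s₀ : Fin k → M) (σ : ℕ → M) (T : ℕ) : ℝ :=
  ⨆ p : Fin (T + 1) × Fin k × Fin k,
    dist (A.config s₀ σ p.1 p.2.1) (A.config s₀ σ p.1 p.2.2)

end Base

/-- State of the phased random swapping algorithm.
* `pos i` : position of server `i`;
* `role i` : the server of the base algorithm whose workload server `i` currently carries out;
* `phase` : the phase number;
* `acc` : cost of the base algorithm accumulated in the current phase;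
* `paid i` : the distance server `i` has moved so far, swaps included. -/
structure PhasedState (k : ℕ) (M : Type*) where
  pos : Fin k → M
  role : Equiv.Perm (Fin k)
  phase : ℕ
  acc : ℝ
  paid : Fin k → ℝ

section Phased

variable {k : ℕ} {M : Type*} [MetricSpace M]

/-- A swap: server `i` moves to the position of server `p i` and takes over its workload. -/
def PhasedState.reposition (S : PhasedState k M) (p : Equiv.Perm (Fin k)) : PhasedState k M where
  pos := fun i => S.pos (p i)
  role := S.role * p
  phase := S.phase
  acc := S.acc
  paid := fun i => S.paid i + dist (S.pos i) (S.pos (p i))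

/-- Every server moves to where the base algorithm puts its role; `u` is the cost of the base
algorithm in this step, `conf` its new configuration. -/
def PhasedState.serve (S : PhasedState k M) (conf : Fin k → M) (u : ℝ) : PhasedState k M where
  pos := fun i => conf (S.role i)
  role := S.role
  phase := S.phase
  acc := S.acc + u
  paid := fun i => S.paid i + dist (S.pos i) (conf (S.role i))

/-- If the phase budget `phase ^ γ` is used up, start the next phase and swap with the permutation
drawn for that phase. -/
def PhasedState.endPhase (γ : ℝ) (π : ℕ → Equiv.Perm (Fin k)) (S : PhasedState k M) :
    PhasedState k M :=
  open Classical in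
  if (S.phase : ℝ) ^ γ ≤ S.acc then
    PhasedState.reposition { S with phase := S.phase + 1, acc := 0 } (π (S.phase + 1))
  else S

/-- The phased random swapping algorithm with base algorithm `A` and phase exponent `γ`, where `π l`
is the permutation drawn at the start of phase `l` (the first phase is phase `1`): its state after
the first `t` requests. -/
def phasedRun (A : OnlineAlgorithm k M) (γ : ℝ) (s₀ : Fin k → M) (σ : ℕ → M)
    (π : ℕ → Equiv.Perm (Fin k)) : ℕ → PhasedState k M
  | 0 => PhasedState.reposition ⟨s₀, 1, 1, 0, fun _ => 0⟩ (π 1)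
  | t + 1 => ((phasedRun A γ s₀ σ π t).serve (A.config s₀ σ (t + 1))
      (∑ i, A.moveCost s₀ σ t i)).endPhase γ π

/-- The cost that server `i` incurs in the phased random swapping algorithm on the first `T`
requests. -/
def phasedCost (A : OnlineAlgorithm k M) (γ : ℝ) (s₀ : Fin k → M) (σ : ℕ → M) (T : ℕ)
    (π : ℕ → Equiv.Perm (Fin k)) (i : Fin k) : ℝ :=
  (phasedRun A γ s₀ σ π T).paid i

end Phased

end

end KServer

/-! Phase boundaries depend only on the costs of `A`, never on the permutations. The role of server
`i` in phase `l` is therefore the product of the first `l` permutations applied to `i`. Partial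
products of independent uniform group elements are again independent and uniform
(`sum_prod_partialProd`), so server `i` carries out an independent, uniformly chosen workload in
each phase.

The cost of server `i` splits into three parts. Swaps: each costs at most `diam`. Because the
budgets sum to order `N ^ (γ + 1) / (γ + 1)`, at most `2 * cost ^ (1 / (γ + 1))` phases end
(`phaseCount_sub_one_le`). Requests that end a phase: these may overshoot the budget arbitrarily,
but all servers then move almost equally far, so each pays its fair share up to `2 * diam`
(`OnlineAlgorithm.moveCost_le`). All other requests: within one phase they cost at most the budget,
hence at most `N ^ γ`, and a Chernoff bound for independent bounded variables applies
(`card_tail_le`).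

A union bound over the servers gives the first claim, after `exponent_le` compares `N ^ γ` with the
total cost. The second claim needs only the swap bound, since permuting roles preserves total
movement. -/

namespace KServer

/-! ### Uniform permutations and a Chernoff bound by counting -/

open Finset in
/-- The partial products of a uniformly random tuple in a finite group are again uniform and
independent. -/
theorem sum_prod_partialProd {G : Type*} [Group G] [Fintype G] (n : ℕ) (F : Fin n → G → ℝ) (q : G) :
    ∑ p : Fin n → G, ∏ j : Fin n, F j (q * Fin.partialProd p j.succ) = ∏ j, ∑ g, F j g := by
  induction n generalizing q with
  | zero => simp
  | succ n ih =>
    -- The first factor is absorbed into the prefix `q`, which the induction leaves arbitrary;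
    -- translation invariance of the sum over `G` removes `q` at the end.
    rw [← (Fin.consEquiv (fun _ : Fin (n + 1) => G)).sum_comp, Fintype.sum_prod_type,
      Fin.prod_univ_succ]
    have h : ∀ g : G, ∑ p : Fin n → G, ∏ j : Fin (n + 1),
        F j (q * Fin.partialProd (Fin.consEquiv (fun _ : Fin (n + 1) => G) (g, p)) j.succ) =
          F 0 (q * g) * ∏ j : Fin n, ∑ g, F j.succ g := by
      intro g
      rw [← ih (fun j => F j.succ) (q * g), mul_sum]
      refine sum_congr rfl fun p _ => ?_
      have hs : ∀ j : Fin (n + 1), q * Fin.partialProd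
          (Fin.consEquiv (fun _ : Fin (n + 1) => G) (g, p)) j.succ =
          q * g * Fin.partialProd p j := by
        intro j
        rw [Fin.partialProd_succ', mul_assoc]
        rfl
      simp only [hs]
      rw [Fin.prod_univ_succ]
      simp
    simp only [h]
    rw [← sum_mul]
    congr 1
    exact _root_.Equiv.sum_comp (Equiv.mulLeft q) (F 0)

open Finset in
-- Right translation by a transposition shows that the left sum does not depend on `i`; averaging
-- over `i` then gives the claim by double counting.
theorem card_mul_sum_perm_apply {ι : Type*} [Fintype ι] [DecidableEq ι] (h : ι → ℝ) (i : ι) :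
    (Fintype.card ι : ℝ) * ∑ g : Equiv.Perm ι, h (g i) =
      (Fintype.card (Equiv.Perm ι) : ℝ) * ∑ j, h j := by
  have h1 : ∀ i', ∑ g : Equiv.Perm ι, h (g i') = ∑ g : Equiv.Perm ι, h (g i) := by
    intro i'
    rw [← _root_.Equiv.sum_comp (Equiv.mulRight (Equiv.swap i i'))]
    simp
  have h2 : ∑ i', ∑ g : Equiv.Perm ι, h (g i') = Fintype.card ι * ∑ g : Equiv.Perm ι, h (g i) := by
    rw [sum_congr rfl fun i' _ => h1 i']; simp
  rw [← h2, sum_comm, sum_congr rfl fun g _ => Equiv.sum_comp g h]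
  simp

/-- By convexity, the exponential lies below its chord on the segment from `0` to `θ`. -/
theorem exp_mul_le_of_mem_unit {θ x : ℝ} (h0 : 0 ≤ x) (h1 : x ≤ 1) :
    Real.exp (θ * x) ≤ 1 + (Real.exp θ - 1) * x := by
  have := convexOn_exp.2 (Set.mem_univ 0) (Set.mem_univ θ) (sub_nonneg.2 h1) h0 (by ring)
  simp only [smul_eq_mul, mul_zero, zero_add, Real.exp_zero] at this
  rw [mul_comm θ x]
  linarith

/-- The exponent in the multiplicative Chernoff bound. -/
theorem exists_chernoff_exponent {ε : ℝ} (hε : 0 < ε) :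
    ∃ θ : ℝ, 0 < θ ∧ Real.exp θ - 1 - θ - θ * ε ≤ -(min ε (ε ^ 2) / 4) := by
  have key : ∀ θ : ℝ, 0 ≤ θ → θ ≤ 1 → Real.exp θ - 1 - θ ≤ θ ^ 2 := by
    intro θ h0 h1
    have := Real.abs_exp_sub_one_sub_id_le (x := θ) (by rw [abs_of_nonneg h0]; exact h1)
    exact (le_abs_self _).trans this
  rcases le_total ε 1 with h | h
  · refine ⟨ε / 2, by positivity, ?_⟩
    have := key (ε / 2) (by positivity) (by linarith)
    have := min_le_right ε (ε ^ 2)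
    nlinarith
  · refine ⟨1 / 2, by positivity, ?_⟩
    have := key (1 / 2) (by positivity) (by linarith)
    have := min_le_left ε (ε ^ 2)
    nlinarith

open Finset in
/-- Chernoff bound for the load of a fixed server under uniformly random swaps, by counting. -/
theorem card_tail_le {k : ℕ} (hk : 0 < k) {n : ℕ} (W : Fin n → Fin k → ℝ) {B M ε : ℝ}
    (hB : 0 < B) (hW0 : ∀ l j, 0 ≤ W l j) (hWB : ∀ l j, W l j ≤ B)
    (hM : (∑ l, ∑ j, W l j) / k ≤ M) (hε : 0 < ε) (i : Fin k) :
    (#{p : Fin n → Equiv.Perm (Fin k) | (∑ l, ∑ j, W l j) / k + ε * M <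
        ∑ l, W l (Fin.partialProd p l.succ i)} : ℝ) ≤
      ((k.factorial : ℕ) : ℝ) ^ n * Real.exp (-(min ε (ε ^ 2) / 4 * (M / B))) := by
  obtain ⟨θ, hθ, hθ'⟩ := exists_chernoff_exponent hε
  have hk' : (0 : ℝ) < k := by exact_mod_cast hk
  set μ := (∑ l, ∑ j, W l j) / (k : ℝ) with hμ
  have hfac : ∀ l, ∑ g : Equiv.Perm (Fin k), Real.exp (θ * (W l (g i) / B)) ≤
      (k.factorial : ℝ) * Real.exp ((Real.exp θ - 1) * ((∑ j, W l j) / k / B)) := by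
    intro l
    have h1 := card_mul_sum_perm_apply (fun j => Real.exp (θ * (W l j / B))) i
    rw [Fintype.card_perm, Fintype.card_fin] at h1
    have h2 : ∑ j, Real.exp (θ * (W l j / B)) ≤
        k * (1 + (Real.exp θ - 1) * ((∑ j, W l j) / k / B)) := by
      calc ∑ j, Real.exp (θ * (W l j / B)) ≤ ∑ j, (1 + (Real.exp θ - 1) * (W l j / B)) :=
            sum_le_sum fun j _ => exp_mul_le_of_mem_unit (div_nonneg (hW0 l j) hB.le)
              ((div_le_one hB).2 (hWB l j))
        _ = k * (1 + (Real.exp θ - 1) * ((∑ j, W l j) / k / B)) := by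
            rw [sum_add_distrib, ← mul_sum, ← sum_div]
            simp only [sum_const, card_univ, Fintype.card_fin, nsmul_eq_mul, mul_one]
            field_simp
    have h3 := Real.add_one_le_exp ((Real.exp θ - 1) * ((∑ j, W l j) / k / B))
    refine le_of_mul_le_mul_left ?_ hk'
    rw [h1]
    calc (k.factorial : ℝ) * ∑ j, Real.exp (θ * (W l j / B))
        ≤ k.factorial * (k * Real.exp ((Real.exp θ - 1) * ((∑ j, W l j) / k / B))) := by
          gcongr
          refine h2.trans ?_
          gcongr
          linarith
      _ = _ := by ring
  have hmgf : ∑ p : Fin n → Equiv.Perm (Fin k),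
      Real.exp (θ * ((∑ l, W l (Fin.partialProd p l.succ i)) / B)) ≤
      (k.factorial : ℝ) ^ n * Real.exp ((Real.exp θ - 1) * (μ / B)) := by
    have h := sum_prod_partialProd n
      (fun l (g : Equiv.Perm (Fin k)) => Real.exp (θ * (W l (g i) / B))) 1
    simp only [one_mul, ← Real.exp_sum, ← mul_sum, ← sum_div] at h
    rw [h]
    calc _ ≤ ∏ l : Fin n, ((k.factorial : ℝ) *
          Real.exp ((Real.exp θ - 1) * ((∑ j, W l j) / k / B))) :=
          prod_le_prod (fun l _ => sum_nonneg fun g _ => (Real.exp_pos _).le) fun l _ => hfac l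
      _ = _ := by
          rw [prod_mul_distrib, ← Real.exp_sum, ← mul_sum, ← sum_div, ← sum_div]
          simp [hμ]
  have hcount : (#{p : Fin n → Equiv.Perm (Fin k) | μ + ε * M <
        ∑ l, W l (Fin.partialProd p l.succ i)} : ℝ) * Real.exp (θ * ((μ + ε * M) / B)) ≤
      ∑ p : Fin n → Equiv.Perm (Fin k),
        Real.exp (θ * ((∑ l, W l (Fin.partialProd p l.succ i)) / B)) := by
    rw [← nsmul_eq_mul, ← sum_const]
    refine (sum_le_sum fun p hp => ?_).trans
      (sum_le_sum_of_subset_of_nonneg (filter_subset _ _) fun p _ _ => (Real.exp_pos _).le)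
    have := (mem_filter.1 hp).2
    gcongr
  have hexp : Real.exp ((Real.exp θ - 1) * (μ / B)) ≤
      Real.exp (-(min ε (ε ^ 2) / 4 * (M / B))) * Real.exp (θ * ((μ + ε * M) / B)) := by
    rw [← Real.exp_add]
    gcongr
    have hμM : μ / B ≤ M / B := by gcongr
    have hμ0 : 0 ≤ μ / B :=
      div_nonneg (div_nonneg (sum_nonneg fun l _ => sum_nonneg fun j _ => hW0 l j) hk'.le) hB.le
    have h1 := Real.add_one_le_exp θ
    -- The true mean `μ` may be replaced by its upper bound `M` because this coefficient is
    -- nonnegative.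
    have h2 : (Real.exp θ - 1 - θ) * (μ / B) ≤ (Real.exp θ - 1 - θ) * (M / B) :=
      mul_le_mul_of_nonneg_left hμM (by linarith)
    have h3 := mul_le_mul_of_nonneg_right hθ' (hμ0.trans hμM)
    have h4 : θ * ((μ + ε * M) / B) = θ * (μ / B) + θ * ε * (M / B) := by ring
    rw [h4]
    linarith
  refine le_of_mul_le_mul_right ((hcount.trans hmgf).trans ?_)
    (Real.exp_pos (θ * ((μ + ε * M) / B)))
  rw [mul_assoc]
  gcongr

/-! ### The law of the tuple of drawn permutations -/

/-- The role permutation after the first `n` swaps. -/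
def rolePerm {G : Type*} [Group G] (π : ℕ → G) : ℕ → G
  | 0 => 1
  | n + 1 => rolePerm π n * π (n + 1)

theorem rolePerm_eq_partialProd {G : Type*} [Group G] (π : ℕ → G) {n : ℕ} (j : Fin (n + 1)) :
    rolePerm π j = Fin.partialProd (fun l : Fin n => π (l + 1)) j := by
  induction j using Fin.induction with
  | zero => simp [rolePerm]
  | succ j ih => rw [Fin.partialProd_succ, ← ih]; simp [rolePerm]

theorem IsUniformPermSeq.prob_tuple_eq {k : ℕ} {Ω : Type*} [MeasurableSpace Ω] {P : Measure Ω}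
    {π : ℕ → Ω → Equiv.Perm (Fin k)} (h : IsUniformPermSeq P π) (n : ℕ)
    (p : Fin n → Equiv.Perm (Fin k)) :
    P {ω | (fun l : Fin n => π (l + 1) ω) = p} = (((k.factorial : ℕ) : ENNReal)⁻¹) ^ n ∧
      MeasurableSet {ω | (fun l : Fin n => π (l + 1) ω) = p} := by
  have hset : {ω | (fun l : Fin n => π (l + 1) ω) = p} =
      ⋂ l ∈ (Finset.univ : Finset (Fin n)), (fun ω => π (l + 1) ω) ⁻¹' {p l} := by
    ext ω; simp [funext_iff]
  have hinj : Function.Injective (fun l : Fin n => (l : ℕ) + 1) := by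
    intro a b hab; simpa [Fin.ext_iff] using hab
  have hind := h.indep.precomp hinj
  rw [hset]
  refine ⟨?_, ?_⟩
  · rw [hind.measure_inter_preimage_eq_mul Finset.univ (sets := fun l => {p l})
      (fun _ _ => trivial)]
    exact (Finset.prod_congr rfl fun (l : Fin n) _ => h.prob_eq (l + 1) (p l)).trans (by simp)
  · exact Finset.measurableSet_biInter _ fun (l : Fin n) _ => h.measurableSet_eq (l + 1) (p l)

open Finset in
theorem IsUniformPermSeq.prob_tuple_mem {k : ℕ} {Ω : Type*} [MeasurableSpace Ω] {P : Measure Ω}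
    [IsProbabilityMeasure P]
    {π : ℕ → Ω → Equiv.Perm (Fin k)} (h : IsUniformPermSeq P π) (n : ℕ)
    (S : Finset (Fin n → Equiv.Perm (Fin k))) :
    P.real {ω | (fun l : Fin n => π (l + 1) ω) ∈ S} = #S / ((k.factorial : ℕ) : ℝ) ^ n := by
  have hset : {ω | (fun l : Fin n => π (l + 1) ω) ∈ S} =
      ⋃ p ∈ S, {ω | (fun l : Fin n => π (l + 1) ω) = p} := by
    ext ω; simp
  rw [measureReal_def, hset, measure_biUnion_finset]
  · rw [sum_congr rfl fun p _ => (h.prob_tuple_eq n p).1]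
    simp [div_eq_mul_inv]
  · intro p _ q _ hpq
    exact Set.disjoint_left.2 fun ω h1 h2 => hpq (h1.symm.trans h2)
  · exact fun p _ => (h.prob_tuple_eq n p).2

/-! ### The deterministic phase clock -/

section Clock

/-- Number and accumulated cost of the current phase after `t` requests, when request `s` costs
`u s`. -/
noncomputable def clock (γ : ℝ) (u : ℕ → ℝ) : ℕ → ℕ × ℝ
  | 0 => (1, 0)
  | t + 1 =>
    open Classical in
    if ((clock γ u t).1 : ℝ) ^ γ ≤ (clock γ u t).2 + u t then ((clock γ u t).1 + 1, 0)
    else ((clock γ u t).1, (clock γ u t).2 + u t)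

/-- The phase ends with request `t`. -/
def EndsAt (γ : ℝ) (u : ℕ → ℝ) (t : ℕ) : Prop :=
  ((clock γ u t).1 : ℝ) ^ γ ≤ (clock γ u t).2 + u t

variable {γ : ℝ} {u : ℕ → ℝ}

theorem clock_succ_of_endsAt {t : ℕ} (h : EndsAt γ u t) :
    clock γ u (t + 1) = ((clock γ u t).1 + 1, 0) := by
  rw [EndsAt] at h
  rw [clock, if_pos h]

theorem clock_succ_of_not_endsAt {t : ℕ} (h : ¬ EndsAt γ u t) :
    clock γ u (t + 1) = ((clock γ u t).1, (clock γ u t).2 + u t) := by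
  rw [EndsAt] at h
  rw [clock, if_neg h]

theorem clock_fst_pos (t : ℕ) : 1 ≤ (clock γ u t).1 := by
  induction t with
  | zero => simp [clock]
  | succ t ih =>
    by_cases h : EndsAt γ u t
    · rw [clock_succ_of_endsAt h]; simp
    · rw [clock_succ_of_not_endsAt h]; exact ih

theorem clock_fst_mono : Monotone fun t => (clock γ u t).1 := by
  refine monotone_nat_of_le_succ fun t => ?_
  by_cases h : EndsAt γ u t
  · rw [clock_succ_of_endsAt h]; simp
  · rw [clock_succ_of_not_endsAt h]

open Finset in
-- Every completed phase has used up at least its budget. Equality can fail because the overshoot is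
-- discarded when the accumulator is reset.
theorem sum_budget_add_acc_le (T : ℕ) :
    ∑ l ∈ range ((clock γ u T).1 - 1), ((l : ℝ) + 1) ^ γ + (clock γ u T).2 ≤
      ∑ t ∈ range T, u t := by
  induction T with
  | zero => simp [clock]
  | succ T ih =>
    rw [sum_range_succ _ T]
    have hp := clock_fst_pos (γ := γ) (u := u) T
    by_cases h : EndsAt γ u T
    · rw [clock_succ_of_endsAt h]
      obtain ⟨m, hm⟩ : ∃ m, (clock γ u T).1 = m + 1 := ⟨_, (Nat.sub_add_cancel hp).symm⟩
      rw [EndsAt] at h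
      simp only [hm, Nat.add_sub_cancel, sum_range_succ, Nat.cast_add, Nat.cast_one] at h ih ⊢
      linarith
    · rw [clock_succ_of_not_endsAt h]
      linarith

theorem clock_snd_nonneg (hu : ∀ t, 0 ≤ u t) (T : ℕ) : 0 ≤ (clock γ u T).2 := by
  induction T with
  | zero => simp [clock]
  | succ T ih =>
    by_cases h : EndsAt γ u T
    · simp [clock_succ_of_endsAt h]
    · rw [clock_succ_of_not_endsAt h]
      exact add_nonneg ih (hu T)

open Finset Classical in
theorem card_endsAt (T : ℕ) :
    #{t ∈ range T | EndsAt γ u t} = (clock γ u T).1 - 1 := by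
  induction T with
  | zero => simp [clock]
  | succ T ih =>
    have hp := clock_fst_pos (γ := γ) (u := u) T
    rw [range_add_one, filter_insert]
    by_cases h : EndsAt γ u T
    · rw [if_pos h, card_insert_of_notMem (by simp), ih, clock_succ_of_endsAt h]
      simp only; omega
    · rw [if_neg h, ih, clock_succ_of_not_endsAt h]

/-- Sum of `w` over the requests that belong to phase `l + 1` and do not end it. -/
noncomputable def phaseSum (γ : ℝ) (u : ℕ → ℝ) (T : ℕ) (w : ℕ → ℝ) (l : ℕ) : ℝ :=
  open Classical in
  ∑ t ∈ Finset.range T, if ¬ EndsAt γ u t ∧ (clock γ u t).1 = l + 1 then w t else 0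

theorem phaseSum_nonneg {w : ℕ → ℝ} (hw : ∀ t, 0 ≤ w t) (T l : ℕ) : 0 ≤ phaseSum γ u T w l :=
  Finset.sum_nonneg fun t _ => by split_ifs; exacts [hw t, le_rfl]

theorem sum_phaseSum {ι : Type*} [Fintype ι] (T l : ℕ) (w : ι → ℕ → ℝ) :
    ∑ j, phaseSum γ u T (w j) l = phaseSum γ u T (fun t => ∑ j, w j t) l := by
  simp only [phaseSum]
  rw [Finset.sum_comm]
  refine Finset.sum_congr rfl fun t _ => ?_
  split_ifs <;> simp

open Finset Classical in
-- Each request that does not end a phase lies in exactly one phase. The weight may depend on the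
-- phase, so that the current role can be inserted.
theorem sum_phaseSum_index (T : ℕ) (w : ℕ → ℕ → ℝ) :
    ∑ l ∈ range (clock γ u T).1, phaseSum γ u T (w (l + 1)) l =
      ∑ t ∈ range T with ¬ EndsAt γ u t, w (clock γ u t).1 t := by
  simp only [phaseSum]
  rw [sum_comm, sum_filter]
  refine sum_congr rfl fun t ht => ?_
  have hp := clock_fst_pos (γ := γ) (u := u) t
  have hle : (clock γ u t).1 ≤ (clock γ u T).1 := clock_fst_mono (mem_range.1 ht).le
  obtain ⟨m, hm⟩ : ∃ m, (clock γ u t).1 = m + 1 := ⟨_, (Nat.sub_add_cancel hp).symm⟩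
  by_cases h : EndsAt γ u t
  · simp [h]
  · rw [sum_eq_single m]
    · simp [h, hm]
    · intro b _ hb
      rw [if_neg]
      rintro ⟨_, h'⟩
      omega
    · intro hm'
      rw [mem_range] at hm'
      omega

theorem phaseSum_succ (T l : ℕ) (w : ℕ → ℝ) :
    phaseSum γ u (T + 1) w l = phaseSum γ u T w l +
      (open Classical in if ¬ EndsAt γ u T ∧ (clock γ u T).1 = l + 1 then w T else 0) := by
  rw [phaseSum, Finset.sum_range_succ, phaseSum]

/-- Before the ending request the accumulated cost is still below the budget; this is why `phaseSum`
omits that request. -/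
theorem phaseSum_le_budget (T l : ℕ) : phaseSum γ u T u l ≤ ((l : ℝ) + 1) ^ γ := by
  -- The induction also needs that the sum of the current phase equals the accumulator and that
  -- later phases are still empty.
  have key : (∀ l, phaseSum γ u T u l ≤ ((l : ℝ) + 1) ^ γ) ∧
      phaseSum γ u T u ((clock γ u T).1 - 1) = (clock γ u T).2 ∧
      ∀ l, (clock γ u T).1 ≤ l → phaseSum γ u T u l = 0 := by
    induction T with
    | zero =>
      have : ∀ l, phaseSum γ u 0 u l = 0 := fun l => by simp [phaseSum]
      refine ⟨fun l => ?_, ?_, fun l _ => this l⟩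
      · rw [this]; positivity
      · rw [this]; simp [clock]
    | succ T ih =>
      obtain ⟨h1, h2, h3⟩ := ih
      have hp := clock_fst_pos (γ := γ) (u := u) T
      obtain ⟨m, hm⟩ : ∃ m, (clock γ u T).1 = m + 1 := ⟨_, (Nat.sub_add_cancel hp).symm⟩
      by_cases h : EndsAt γ u T
      · have : ∀ l, phaseSum γ u (T + 1) u l = phaseSum γ u T u l := by
          intro l; rw [phaseSum_succ]; simp [h]
        simp only [this, clock_succ_of_endsAt h]
        refine ⟨h1, ?_, fun l hl => h3 l (by omega)⟩
        exact h3 _ (by omega)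
      · simp only [phaseSum_succ, clock_succ_of_not_endsAt h, h, not_false_eq_true, true_and]
        rw [hm, Nat.add_sub_cancel] at h2
        refine ⟨fun l => ?_, ?_, fun l hl => ?_⟩
        · split_ifs with hl
          · have hlm : l = m := by omega
            rw [EndsAt, not_le, hm] at h
            rw [hlm, h2]
            push_cast at h
            exact h.le
          · simpa using h1 l
        · rw [hm, Nat.add_sub_cancel, if_pos rfl, h2]
        · rw [if_neg (by omega), h3 l hl, add_zero]
  exact key.1 l

end Clock

/-! ### Growth of the budgets -/

section Budget

theorem rpow_le_mul_sum_budget {γ : ℝ} (hγ : 0 < γ) (m : ℕ) :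
    (m : ℝ) ^ (γ + 1) ≤ (γ + 1) * ∑ l ∈ Finset.range m, ((l : ℝ) + 1) ^ γ := by
  induction m with
  | zero => simp [Real.zero_rpow (by linarith : γ + 1 ≠ 0)]
  | succ m ih =>
    rw [Finset.sum_range_succ, mul_add]
    have hm : (0 : ℝ) < (m : ℝ) + 1 := by positivity
    -- Bernoulli's inequality for `(m / (m + 1)) ^ (γ + 1)` bounds the increment of `m ^ (γ + 1)` by
    -- `(γ + 1) * (m + 1) ^ γ`.
    have hb := one_add_mul_self_le_rpow_one_add (s := -(1 / ((m : ℝ) + 1)))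
      (by rw [neg_le_neg_iff, div_le_one hm]; linarith [(Nat.cast_nonneg m : (0 : ℝ) ≤ m)])
      (p := γ + 1) (by linarith)
    have h1 : 1 + -(1 / ((m : ℝ) + 1)) = m / (m + 1) := by field_simp; ring
    rw [h1, Real.div_rpow (Nat.cast_nonneg m) hm.le, le_div_iff₀ (by positivity)] at hb
    have h2 : ((m : ℝ) + 1) ^ (γ + 1) = ((m : ℝ) + 1) ^ γ * (m + 1) := by
      rw [Real.rpow_add hm, Real.rpow_one]
    push_cast
    have h3 : (1 + (γ + 1) * -(1 / ((m : ℝ) + 1))) * (m + 1) ^ (γ + 1) =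
        (m + 1) ^ (γ + 1) - (γ + 1) * (m + 1) ^ γ := by
      rw [h2]; field_simp; ring
    linarith

/-- Since `γ + 1 ≤ 2 ^ (γ + 1)`, the factor `γ + 1` costs only a constant independent of `γ`. -/
theorem le_two_mul_of_rpow_le {γ x Z : ℝ} (hγ : 0 < γ) (hx : 0 ≤ x) (hZ : 0 ≤ Z)
    (h : x ^ (γ + 1) ≤ (γ + 1) * Z ^ (γ + 1)) : x ≤ 2 * Z := by
  have hb := one_add_mul_self_le_rpow_one_add (s := 1) (by norm_num) (p := γ + 1) (by linarith)
  norm_num at hb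
  rw [← Real.rpow_le_rpow_iff hx (by positivity) (by linarith : 0 < γ + 1),
    Real.mul_rpow (by norm_num) hZ]
  refine h.trans ?_
  gcongr
  linarith

/-- Here `m` counts completed phases, so the left side is the current budget. If `m < γ`, then `m +
1 ≤ Z`. Otherwise passing from `m` to `m + 1` costs a factor of at most `exp (γ / m) ≤ 3`. -/
theorem add_one_rpow_le {γ Z : ℝ} (hγ : 0 < γ) (hZ : γ + 1 ≤ Z) (m : ℕ)
    (h : (m : ℝ) ^ (γ + 1) ≤ (γ + 1) * Z ^ (γ + 1)) :
    ((m : ℝ) + 1) ^ γ ≤ 3 * (γ + 1) * Z ^ γ := by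
  have hZ0 : 0 < Z := by linarith
  have hm0 : (0 : ℝ) ≤ m := Nat.cast_nonneg m
  have hZγ : 0 < Z ^ γ := Real.rpow_pos_of_pos hZ0 γ
  rcases lt_or_ge (m : ℝ) γ with hm | hm
  · have : ((m : ℝ) + 1) ^ γ ≤ Z ^ γ := by gcongr; linarith
    nlinarith
  · have hmpos : (0 : ℝ) < m := hγ.trans_le hm
    have h1 : (m : ℝ) ^ γ ≤ (γ + 1) * Z ^ γ := by
      rcases le_total (m : ℝ) Z with hmZ | hmZ
      · have : (m : ℝ) ^ γ ≤ Z ^ γ := by gcongr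
        nlinarith
      · rw [Real.rpow_add hmpos, Real.rpow_add hZ0, Real.rpow_one, Real.rpow_one] at h
        refine le_of_mul_le_mul_right (h.trans ?_) hmpos
        rw [← mul_assoc]
        gcongr
    have h2 : (1 + 1 / (m : ℝ)) ^ γ ≤ 3 := by
      calc (1 + 1 / (m : ℝ)) ^ γ ≤ Real.exp (1 / m) ^ γ := by
            gcongr
            linarith [Real.add_one_le_exp (1 / (m : ℝ))]
        _ = Real.exp (γ / m) := by rw [← Real.exp_mul]; ring_nf
        _ ≤ Real.exp 1 := by
            gcongr
            exact (div_le_one hmpos).2 hm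
        _ ≤ 3 := by linarith [Real.exp_one_lt_d9]
    have h3 : (m : ℝ) + 1 = m * (1 + 1 / m) := by field_simp
    rw [h3, Real.mul_rpow hm0 (by positivity)]
    calc (m : ℝ) ^ γ * (1 + 1 / (m : ℝ)) ^ γ ≤ ((γ + 1) * Z ^ γ) * 3 := by gcongr
      _ = _ := by ring

end Budget

/-! ### The run of the algorithm in terms of the clock -/

section Run

variable {k : ℕ} {M : Type*} [MetricSpace M] (A : OnlineAlgorithm k M) (γ : ℝ) (s₀ : Fin k → M)
  (σ : ℕ → M)

/-- The cost of `A` on request `t`. -/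
noncomputable def OnlineAlgorithm.stepCost (t : ℕ) : ℝ := ∑ i, A.moveCost s₀ σ t i

theorem OnlineAlgorithm.moveCost_nonneg (t : ℕ) (i : Fin k) : 0 ≤ A.moveCost s₀ σ t i :=
  dist_nonneg

theorem OnlineAlgorithm.stepCost_nonneg (t : ℕ) : 0 ≤ A.stepCost s₀ σ t :=
  Finset.sum_nonneg fun i _ => A.moveCost_nonneg s₀ σ t i

theorem OnlineAlgorithm.cost_eq_sum_stepCost (T : ℕ) :
    A.cost s₀ σ T = ∑ t ∈ Finset.range T, A.stepCost s₀ σ t :=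
  Finset.sum_comm

theorem OnlineAlgorithm.dist_config_le_diam {t T : ℕ} (ht : t ≤ T) (i j : Fin k) :
    dist (A.config s₀ σ t i) (A.config s₀ σ t j) ≤ A.diam s₀ σ T :=
  le_ciSup (f := fun p : Fin (T + 1) × Fin k × Fin k =>
    dist (A.config s₀ σ p.1 p.2.1) (A.config s₀ σ p.1 p.2.2)) (Set.finite_range _).bddAbove
    (⟨t, Nat.lt_succ_of_le ht⟩, i, j)

theorem OnlineAlgorithm.diam_nonneg (T : ℕ) : 0 ≤ A.diam s₀ σ T :=
  Real.iSup_nonneg fun _ => dist_nonneg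

/-- Two servers are within `diam` of each other both before and after the request, so their
displacements differ by at most `2 * diam`. Averaging over all servers gives the bound. -/
theorem OnlineAlgorithm.moveCost_le {t T : ℕ} (ht : t < T) (i : Fin k) :
    A.moveCost s₀ σ t i ≤ A.stepCost s₀ σ t / k + 2 * A.diam s₀ σ T := by
  have hk : (0 : ℝ) < k := by exact_mod_cast i.pos
  have h : ∀ j, A.moveCost s₀ σ t i ≤ A.moveCost s₀ σ t j + 2 * A.diam s₀ σ T := by
    intro j
    have h1 := A.dist_config_le_diam s₀ σ ht.le i j
    have h2 := A.dist_config_le_diam s₀ σ (Nat.succ_le_of_lt ht) j i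
    have h3 := dist_triangle4 (A.config s₀ σ t i) (A.config s₀ σ t j) (A.config s₀ σ (t + 1) j)
      (A.config s₀ σ (t + 1) i)
    simp only [moveCost]
    linarith
  have hs := Finset.sum_le_sum fun j (_ : j ∈ Finset.univ) => h j
  rw [Finset.sum_add_distrib] at hs
  simp only [Finset.sum_const, Finset.card_univ, Fintype.card_fin, nsmul_eq_mul] at hs
  have : A.stepCost s₀ σ t / k + 2 * A.diam s₀ σ T =
      (A.stepCost s₀ σ t + k * (2 * A.diam s₀ σ T)) / k := by field_simp
  rw [this, le_div_iff₀ hk, mul_comm]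
  exact hs

variable (π : ℕ → Equiv.Perm (Fin k))

/-- Phase number and accumulator do not involve `π`; randomness enters only through the roles. -/
theorem phasedRun_state (t : ℕ) :
    (phasedRun A γ s₀ σ π t).phase = (clock γ (A.stepCost s₀ σ) t).1 ∧
    (phasedRun A γ s₀ σ π t).acc = (clock γ (A.stepCost s₀ σ) t).2 ∧
    (phasedRun A γ s₀ σ π t).role = rolePerm π (clock γ (A.stepCost s₀ σ) t).1 ∧
    (phasedRun A γ s₀ σ π t).pos =
      fun i => A.config s₀ σ t (rolePerm π (clock γ (A.stepCost s₀ σ) t).1 i) := by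
  induction t with
  | zero => simp [phasedRun, PhasedState.reposition, clock, rolePerm, OnlineAlgorithm.config]
  | succ t ih =>
    obtain ⟨h1, h2, h3, h4⟩ := ih
    rw [phasedRun, PhasedState.endPhase]
    simp only [PhasedState.serve, h1, h2]
    by_cases h : EndsAt γ (A.stepCost s₀ σ) t
    · have h' : ((clock γ (A.stepCost s₀ σ) t).1 : ℝ) ^ γ ≤
          (clock γ (A.stepCost s₀ σ) t).2 + ∑ i, A.moveCost s₀ σ t i := h
      rw [if_pos h', clock_succ_of_endsAt h]
      simp [PhasedState.reposition, h3, rolePerm]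
    · have h' : ¬ ((clock γ (A.stepCost s₀ σ) t).1 : ℝ) ^ γ ≤
          (clock γ (A.stepCost s₀ σ) t).2 + ∑ i, A.moveCost s₀ σ t i := h
      rw [if_neg h', clock_succ_of_not_endsAt h]
      simp [h3, OnlineAlgorithm.stepCost]

/-- The initial swap is kept exact: bounding it by `diam` would be too weak when all servers start
at one point and the cost is small. -/
theorem phasedCost_le (i : Fin k) {T : ℕ} :
    phasedCost A γ s₀ σ T π i ≤ dist (s₀ i) (s₀ (π 1 i)) +
      (((clock γ (A.stepCost s₀ σ) T).1 : ℝ) - 1) * A.diam s₀ σ T +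
      ∑ t ∈ Finset.range T,
        A.moveCost s₀ σ t (rolePerm π (clock γ (A.stepCost s₀ σ) t).1 i) := by
  suffices H : ∀ t ≤ T, phasedCost A γ s₀ σ t π i ≤ dist (s₀ i) (s₀ (π 1 i)) +
      (((clock γ (A.stepCost s₀ σ) t).1 : ℝ) - 1) * A.diam s₀ σ T +
      ∑ s ∈ Finset.range t,
        A.moveCost s₀ σ s (rolePerm π (clock γ (A.stepCost s₀ σ) s).1 i) from H T le_rfl
  intro t
  induction t with
  | zero => simp [phasedCost, phasedRun, PhasedState.reposition, clock]
  | succ t ih =>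
    intro ht
    have ih := ih (by omega)
    obtain ⟨h1, h2, h3, h4⟩ := phasedRun_state A γ s₀ σ π t
    rw [Finset.sum_range_succ]
    rw [phasedCost] at ih ⊢
    rw [phasedRun, PhasedState.endPhase]
    simp only [PhasedState.serve, h1, h2]
    have hmove : dist ((phasedRun A γ s₀ σ π t).pos i)
        (A.config s₀ σ (t + 1) ((phasedRun A γ s₀ σ π t).role i)) =
        A.moveCost s₀ σ t (rolePerm π (clock γ (A.stepCost s₀ σ) t).1 i) := by
      rw [h3, h4]; rfl
    by_cases h : EndsAt γ (A.stepCost s₀ σ) t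
    · have h' : ((clock γ (A.stepCost s₀ σ) t).1 : ℝ) ^ γ ≤
          (clock γ (A.stepCost s₀ σ) t).2 + ∑ i, A.moveCost s₀ σ t i := h
      rw [if_pos h', clock_succ_of_endsAt h]
      simp only [PhasedState.reposition]
      rw [hmove]
      have := A.dist_config_le_diam s₀ σ ht ((phasedRun A γ s₀ σ π t).role i)
        ((phasedRun A γ s₀ σ π t).role (π ((clock γ (A.stepCost s₀ σ) t).1 + 1) i))
      push_cast
      linarith
    · have h' : ¬ ((clock γ (A.stepCost s₀ σ) t).1 : ℝ) ^ γ ≤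
          (clock γ (A.stepCost s₀ σ) t).2 + ∑ i, A.moveCost s₀ σ t i := h
      rw [if_neg h', clock_succ_of_not_endsAt h]
      simp only
      rw [hmove]
      linarith

end Run

/-! ### Cost bounds valid for every outcome -/

section Bounds

variable {k : ℕ} {M : Type*} [MetricSpace M] (A : OnlineAlgorithm k M) (γ : ℝ) (s₀ : Fin k → M)
  (σ : ℕ → M) (T : ℕ)

/-- The number of phases that phased random swapping starts during the first `T` requests. -/
noncomputable def phaseCount : ℕ := (clock γ (A.stepCost s₀ σ) T).1

/-- The distance moved by server `j` of `A` in phase `l + 1`, without the request ending it. -/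
noncomputable def phaseLoad (l : ℕ) (j : Fin k) : ℝ :=
  phaseSum γ (A.stepCost s₀ σ) T (fun t => A.moveCost s₀ σ t j) l

theorem OnlineAlgorithm.cost_nonneg : 0 ≤ A.cost s₀ σ T :=
  Finset.sum_nonneg fun i _ => Finset.sum_nonneg fun t _ => A.moveCost_nonneg s₀ σ t i

theorem phaseLoad_nonneg (l : ℕ) (j : Fin k) : 0 ≤ phaseLoad A γ s₀ σ T l j :=
  phaseSum_nonneg (fun t => A.moveCost_nonneg s₀ σ t j) T l

theorem sum_phaseLoad_le (l : ℕ) : ∑ j, phaseLoad A γ s₀ σ T l j ≤ ((l : ℝ) + 1) ^ γ := by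
  simp only [phaseLoad, sum_phaseSum]
  exact phaseSum_le_budget T l

variable {γ}

theorem phaseLoad_le (hγ : 0 ≤ γ) {l : ℕ} (hl : l < phaseCount A γ s₀ σ T) (j : Fin k) :
    phaseLoad A γ s₀ σ T l j ≤ (phaseCount A γ s₀ σ T : ℝ) ^ γ := by
  refine (Finset.single_le_sum (fun j _ => phaseLoad_nonneg A γ s₀ σ T l j)
    (Finset.mem_univ j)).trans ((sum_phaseLoad_le A γ s₀ σ T l).trans ?_)
  gcongr
  exact_mod_cast hl

theorem phaseCount_sub_one_rpow_le (hγ : 0 < γ) :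
    (phaseCount A γ s₀ σ T - 1 : ℕ) ^ (γ + 1) ≤ (γ + 1) * A.cost s₀ σ T := by
  refine (rpow_le_mul_sum_budget hγ _).trans ?_
  have h1 := sum_budget_add_acc_le (γ := γ) (u := A.stepCost s₀ σ) T
  have h2 := clock_snd_nonneg (γ := γ) (A.stepCost_nonneg s₀ σ) T
  rw [A.cost_eq_sum_stepCost]
  gcongr
  rw [phaseCount]
  linarith

theorem rpow_one_div_rpow (hγ : 0 < γ) {X : ℝ} (hX : 0 ≤ X) :
    (X ^ (1 / (γ + 1))) ^ (γ + 1) = X := by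
  rw [← Real.rpow_mul hX, one_div_mul_cancel (by linarith), Real.rpow_one]

theorem cast_phaseCount_sub_one :
    ((phaseCount A γ s₀ σ T - 1 : ℕ) : ℝ) = phaseCount A γ s₀ σ T - 1 := by
  rw [phaseCount, Nat.cast_sub (clock_fst_pos T), Nat.cast_one]

theorem phaseCount_sub_one_le (hγ : 0 < γ) :
    (phaseCount A γ s₀ σ T : ℝ) - 1 ≤ 2 * A.cost s₀ σ T ^ (1 / (γ + 1)) := by
  have hX := A.cost_nonneg s₀ σ T
  rw [← cast_phaseCount_sub_one]
  refine le_two_mul_of_rpow_le hγ (Nat.cast_nonneg _) (by positivity) ?_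
  rw [rpow_one_div_rpow hγ hX]
  exact phaseCount_sub_one_rpow_le A s₀ σ T hγ

/-- All swaps, together with the overshoot of the requests that end a phase, cost each server
`O(cost ^ (1 / (γ + 1)) * diam)`. -/
theorem swapCost_le (hγ : 0 < γ) (h : 1 ≤ A.cost s₀ σ T ∨ ∀ i j, s₀ i = s₀ j) (i j : Fin k) :
    dist (s₀ i) (s₀ j) + ((phaseCount A γ s₀ σ T : ℝ) - 1) * (3 * A.diam s₀ σ T) ≤
      7 * (A.cost s₀ σ T ^ (1 / (γ + 1)) * A.diam s₀ σ T) := by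
  have hD := A.diam_nonneg s₀ σ T
  have hZ : 0 ≤ A.cost s₀ σ T ^ (1 / (γ + 1)) := Real.rpow_nonneg (A.cost_nonneg s₀ σ T) _
  -- For each ended phase, one `diam` pays for the swap and two for the overshoot.
  have hN := mul_le_mul_of_nonneg_right (phaseCount_sub_one_le A s₀ σ T hγ)
    (by positivity : 0 ≤ 3 * A.diam s₀ σ T)
  have h0 : dist (s₀ i) (s₀ j) ≤ A.cost s₀ σ T ^ (1 / (γ + 1)) * A.diam s₀ σ T := by
    rcases h with h | h
    · have h1 : dist (s₀ i) (s₀ j) ≤ A.diam s₀ σ T :=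
        A.dist_config_le_diam s₀ σ (Nat.zero_le T) i j
      have h2 : 1 ≤ A.cost s₀ σ T ^ (1 / (γ + 1)) := Real.one_le_rpow h (by positivity)
      nlinarith
    · rw [h i j, dist_self]
      positivity
  linarith

theorem sum_phasedCost_le (hγ : 0 < γ) (h : 1 ≤ A.cost s₀ σ T ∨ ∀ i j, s₀ i = s₀ j)
    (π : ℕ → Equiv.Perm (Fin k)) :
    ∑ i, phasedCost A γ s₀ σ T π i ≤
      A.cost s₀ σ T + 7 * (A.cost s₀ σ T ^ (1 / (γ + 1)) * k * A.diam s₀ σ T) := by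
  have hD := A.diam_nonneg s₀ σ T
  have h1 : ∀ i, phasedCost A γ s₀ σ T π i ≤
      7 * (A.cost s₀ σ T ^ (1 / (γ + 1)) * A.diam s₀ σ T) + ∑ t ∈ Finset.range T,
        A.moveCost s₀ σ t (rolePerm π (clock γ (A.stepCost s₀ σ) t).1 i) := by
    intro i
    have h2 := phasedCost_le A γ s₀ σ π i (T := T)
    have h3 := swapCost_le A s₀ σ T hγ h i (π 1 i)
    have h4 : (1 : ℝ) ≤ (clock γ (A.stepCost s₀ σ) T).1 := by exact_mod_cast clock_fst_pos T
    have h5 : 0 ≤ (((clock γ (A.stepCost s₀ σ) T).1 : ℝ) - 1) * A.diam s₀ σ T :=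
      mul_nonneg (by linarith) hD
    rw [phaseCount] at h3
    linarith
  refine (Finset.sum_le_sum fun i _ => h1 i).trans (le_of_eq ?_)
  rw [Finset.sum_add_distrib, Finset.sum_comm, A.cost_eq_sum_stepCost]
  have h2 : ∀ t, ∑ i, A.moveCost s₀ σ t (rolePerm π (clock γ (A.stepCost s₀ σ) t).1 i) =
      A.stepCost s₀ σ t := fun t => _root_.Equiv.sum_comp _ (A.moveCost s₀ σ t)
  simp only [h2, Finset.sum_const, Finset.card_univ, Fintype.card_fin, nsmul_eq_mul]
  ring

open Finset Classical in
theorem sum_phaseLoad_eq :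
    ∑ l : Fin (phaseCount A γ s₀ σ T), ∑ j, phaseLoad A γ s₀ σ T l j =
      ∑ t ∈ range T with ¬ EndsAt γ (A.stepCost s₀ σ) t, A.stepCost s₀ σ t := by
  rw [Fin.sum_univ_eq_sum_range
    (fun l => ∑ j, phaseLoad A γ s₀ σ T l j) (phaseCount A γ s₀ σ T)]
  simp only [phaseLoad, sum_phaseSum]
  exact sum_phaseSum_index T (fun _ t => A.stepCost s₀ σ t)

theorem sum_phaseLoad_le_cost :
    ∑ l : Fin (phaseCount A γ s₀ σ T), ∑ j, phaseLoad A γ s₀ σ T l j ≤ A.cost s₀ σ T := by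
  classical
  rw [sum_phaseLoad_eq, A.cost_eq_sum_stepCost]
  exact Finset.sum_le_sum_of_subset_of_nonneg (Finset.filter_subset _ _)
    fun t _ _ => A.stepCost_nonneg s₀ σ t

open Finset Classical in
-- The ending requests contribute exactly their average to the second term, so only the phase loads
-- remain random.
theorem phasedCost_le_add_load (hγ : 0 < γ) (h : 1 ≤ A.cost s₀ σ T ∨ ∀ i j, s₀ i = s₀ j)
    (π : ℕ → Equiv.Perm (Fin k)) (i : Fin k) :
    phasedCost A γ s₀ σ T π i ≤
      7 * (A.cost s₀ σ T ^ (1 / (γ + 1)) * A.diam s₀ σ T) +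
      (A.cost s₀ σ T - ∑ l : Fin (phaseCount A γ s₀ σ T), ∑ j, phaseLoad A γ s₀ σ T l j) / k +
      ∑ l : Fin (phaseCount A γ s₀ σ T), phaseLoad A γ s₀ σ T l (rolePerm π (l + 1) i) := by
  have h1 := phasedCost_le A γ s₀ σ π i (T := T)
  have h2 := swapCost_le A s₀ σ T hγ h i (π 1 i)
  have hY : ∑ l : Fin (phaseCount A γ s₀ σ T), phaseLoad A γ s₀ σ T l (rolePerm π (l + 1) i) =
      ∑ t ∈ range T with ¬ EndsAt γ (A.stepCost s₀ σ) t,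
        A.moveCost s₀ σ t (rolePerm π (clock γ (A.stepCost s₀ σ) t).1 i) := by
    rw [Fin.sum_univ_eq_sum_range
      (fun l => phaseLoad A γ s₀ σ T l (rolePerm π (l + 1) i)) (phaseCount A γ s₀ σ T)]
    exact sum_phaseSum_index T (fun l t => A.moveCost s₀ σ t (rolePerm π l i))
  have hX' := sum_phaseLoad_eq A (γ := γ) s₀ σ T
  have hX := sum_filter_add_sum_filter_not (range T) (EndsAt γ (A.stepCost s₀ σ))
    (A.stepCost s₀ σ)
  rw [← sum_filter_add_sum_filter_not (range T) (EndsAt γ (A.stepCost s₀ σ)), ← hY] at h1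
  rw [← hX', ← A.cost_eq_sum_stepCost] at hX
  have hE : ∑ t ∈ range T with EndsAt γ (A.stepCost s₀ σ) t,
      A.moveCost s₀ σ t (rolePerm π (clock γ (A.stepCost s₀ σ) t).1 i) ≤
      (∑ t ∈ range T with EndsAt γ (A.stepCost s₀ σ) t, A.stepCost s₀ σ t) / k +
        ((phaseCount A γ s₀ σ T : ℝ) - 1) * (2 * A.diam s₀ σ T) := by
    rw [← cast_phaseCount_sub_one, phaseCount, ← card_endsAt, ← nsmul_eq_mul, ← sum_const,
      sum_div, ← sum_add_distrib]
    exact sum_le_sum fun t ht =>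
      A.moveCost_le s₀ σ (mem_range.1 (mem_filter.1 ht).1) _
  rw [← hX, add_sub_cancel_right]
  rw [hX]
  rw [phaseCount] at h2 hE
  linarith

end Bounds

/-! ### The probabilistic bound -/

/-- If the claimed failure probability is below `1` for some `ε < k - 1`, the phase budget is small
compared to the total cost. -/
theorem exponent_le {γ₀ γ ε X Z : ℝ} {k N : ℕ} (hγ₀ : 0 < γ₀) (hγ : γ₀ ≤ γ) (hk : 0 < k)
    (hε : 0 < ε) (hεk : ε < k - 1) (hN : 1 ≤ N) (hZ : 0 ≤ Z) (hX : X = Z ^ (γ + 1))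
    (hNX : ((N - 1 : ℕ) : ℝ) ^ (γ + 1) ≤ (γ + 1) * X)
    (h : (k : ℝ) * Real.exp (-(γ₀ / (12 * (γ₀ + 1)) * (min ε (ε ^ 2) / (γ * k) * Z))) < 1) :
    γ₀ / (12 * (γ₀ + 1)) * (min ε (ε ^ 2) / (γ * k) * Z) ≤
      min ε (ε ^ 2) / 4 * (X / k / (N : ℝ) ^ γ) := by
  have hγp : 0 < γ := hγ₀.trans_le hγ
  have hk' : (0 : ℝ) < k := by exact_mod_cast hk
  have hk2 : (2 : ℝ) ≤ k := by
    have : (1 : ℝ) < k := by linarith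
    exact_mod_cast this
  have hm : 0 < min ε (ε ^ 2) := lt_min hε (by positivity)
  have hmk : min ε (ε ^ 2) ≤ k := (min_le_left _ _).trans (by linarith)
  have hN' : (0 : ℝ) < N := by exact_mod_cast hN
  -- The function `t / (t + 1)` is increasing, so one constant serves all `γ ≥ γ₀`.
  have hc : γ₀ / (12 * (γ₀ + 1)) ≤ γ / (12 * (γ + 1)) := by
    rw [div_le_div_iff₀ (by positivity) (by positivity)]
    nlinarith
  have hE : γ₀ / (12 * (γ₀ + 1)) * (min ε (ε ^ 2) / (γ * k) * Z) ≤
      min ε (ε ^ 2) / k * (Z / (12 * (γ + 1))) := by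
    calc _ ≤ γ / (12 * (γ + 1)) * (min ε (ε ^ 2) / (γ * k) * Z) := by gcongr
      _ = _ := by field_simp
  -- As `k ≥ 2`, the exponent exceeds `log 2`; it is also at most `Z / (12 * (γ + 1))`, and `12 *
  -- log 2 > 1`.
  have hlog : γ + 1 ≤ Z := by
    have h1 : Real.log 2 < γ₀ / (12 * (γ₀ + 1)) * (min ε (ε ^ 2) / (γ * k) * Z) := by
      rw [Real.exp_neg, ← div_eq_mul_inv, div_lt_one (Real.exp_pos _)] at h
      rw [Real.log_lt_iff_lt_exp (by norm_num)]
      linarith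
    have h2 : min ε (ε ^ 2) / k * (Z / (12 * (γ + 1))) ≤ 1 * (Z / (12 * (γ + 1))) := by
      gcongr
      exact (div_le_one hk').2 hmk
    have h3 : Real.log 2 < Z / (12 * (γ + 1)) := by linarith
    rw [lt_div_iff₀ (by positivity)] at h3
    nlinarith [Real.log_two_gt_d9]
  have hZ0 : 0 < Z := by linarith
  have hB : (N : ℝ) ^ γ ≤ 3 * (γ + 1) * Z ^ γ := by
    have := add_one_rpow_le hγp hlog (N - 1) (by rwa [← hX])
    rwa [Nat.cast_sub hN, Nat.cast_one, sub_add_cancel] at this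
  refine hE.trans ?_
  have hZγ : 0 < Z ^ γ := Real.rpow_pos_of_pos hZ0 γ
  calc min ε (ε ^ 2) / k * (Z / (12 * (γ + 1)))
      = min ε (ε ^ 2) / 4 * (Z ^ γ * Z / k / (3 * (γ + 1) * Z ^ γ)) := by field_simp; ring
    _ ≤ min ε (ε ^ 2) / 4 * (Z ^ γ * Z / k / (N : ℝ) ^ γ) := by gcongr
    _ = _ := by rw [hX, Real.rpow_add hZ0, Real.rpow_one]

open Finset in
theorem prob_phasedCost_le {γ₀ γ ε : ℝ} (hγ₀ : 0 < γ₀) (hγ : γ₀ ≤ γ) (hε : 0 < ε)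
    {k : ℕ} (hk : 0 < k) {M : Type*} [MetricSpace M] (A : OnlineAlgorithm k M) (s₀ : Fin k → M)
    (σ : ℕ → M) (T : ℕ) (h : 1 ≤ A.cost s₀ σ T ∨ ∀ i j, s₀ i = s₀ j)
    {Ω : Type*} [MeasurableSpace Ω] {P : Measure Ω} [IsProbabilityMeasure P]
    {π : ℕ → Ω → Equiv.Perm (Fin k)} (hπ : IsUniformPermSeq P π) :
    1 - (k : ℝ) * Real.exp (-(γ₀ / (12 * (γ₀ + 1)) *
        (min ε (ε ^ 2) / (γ * k) * A.cost s₀ σ T ^ (1 / (γ + 1))))) ≤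
      P.real {ω | ∀ i, phasedCost A γ s₀ σ T (fun l => π l ω) i ≤
        (1 + ε) * (A.cost s₀ σ T / k) +
          7 * (A.cost s₀ σ T ^ (1 / (γ + 1)) * A.diam s₀ σ T)} := by
  classical
  have hγp : 0 < γ := hγ₀.trans_le hγ
  have hk' : (0 : ℝ) < k := by exact_mod_cast hk
  set X := A.cost s₀ σ T with hXdef
  set Z := X ^ (1 / (γ + 1)) with hZdef
  set N := phaseCount A γ s₀ σ T 
  set W : Fin N → Fin k → ℝ := fun l j => phaseLoad A γ s₀ σ T l j with hWdef
  set X' := ∑ l, ∑ j, W l j with hX'def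
  have hX0 : 0 ≤ X := A.cost_nonneg s₀ σ T
  have hZ0 : 0 ≤ Z := Real.rpow_nonneg hX0 _
  have hXZ : X = Z ^ (γ + 1) := (rpow_one_div_rpow hγp hX0).symm
  have hW0 : ∀ l j, 0 ≤ W l j := fun l j => phaseLoad_nonneg A γ s₀ σ T l j
  have hX'X : X' ≤ X := sum_phaseLoad_le_cost A s₀ σ T
  have hgood : ∀ ω i, ∑ l, W l (rolePerm (fun l => π l ω) (l + 1) i) ≤ X' / k + ε * (X / k) →
      phasedCost A γ s₀ σ T (fun l => π l ω) i ≤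
        (1 + ε) * (X / k) + 7 * (Z * A.diam s₀ σ T) := by
    intro ω i hi
    have h1 := phasedCost_le_add_load A s₀ σ T hγp h (fun l => π l ω) i
    have h2 : (X - X') / k = X / k - X' / k := sub_div _ _ _
    simp only [hWdef, hX'def, hZdef, hXdef] at h1 h2 hi ⊢
    linarith
  rcases le_or_gt 1 ((k : ℝ) * Real.exp (-(γ₀ / (12 * (γ₀ + 1)) *
    (min ε (ε ^ 2) / (γ * k) * Z)))) with hE | hE
  · exact (sub_nonpos.2 hE).trans measureReal_nonneg
  -- For `ε ≥ k - 1` the load bound is deterministic, since no server can carry more than the whole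
  -- load `X'`.
  rcases le_or_gt ((k : ℝ) - 1) ε with hεk | hεk
  · have huniv : {ω | ∀ i, phasedCost A γ s₀ σ T (fun l => π l ω) i ≤
        (1 + ε) * (X / k) + 7 * (Z * A.diam s₀ σ T)} = Set.univ := by
      refine Set.eq_univ_of_forall fun ω i => hgood ω i ?_
      have h1 : ∑ l, W l (rolePerm (fun l => π l ω) (l + 1) i) ≤ X' :=
        sum_le_sum fun l _ => single_le_sum (f := W l) (fun j _ => hW0 l j) (mem_univ _)
      refine h1.trans ?_
      rw [mul_div_assoc', ← add_div, le_div_iff₀ hk']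
      have hk1 : (1 : ℝ) ≤ k := by exact_mod_cast hk
      have h2 := mul_le_mul_of_nonneg_right hX'X (sub_nonneg.2 hk1)
      have h3 := mul_le_mul_of_nonneg_left hεk hX0
      linarith
    rw [huniv, probReal_univ]
    have := Real.exp_pos (-(γ₀ / (12 * (γ₀ + 1)) * (min ε (ε ^ 2) / (γ * k) * Z)))
    nlinarith
  have hN1 : 1 ≤ N := clock_fst_pos T
  have hB : (0 : ℝ) < (N : ℝ) ^ γ := Real.rpow_pos_of_pos (by exact_mod_cast hN1) γ
  -- The deviation is measured against the full mean `X / k`, not `X' / k`, so the ending requests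
  -- cause no loss in the exponent.
  set bad : Fin k → Finset (Fin N → Equiv.Perm (Fin k)) := fun i =>
    {p | X' / k + ε * (X / k) < ∑ l, W l (Fin.partialProd p l.succ i)} with hbad
  have hcard : ∀ i, (#(bad i) : ℝ) ≤ ((k.factorial : ℕ) : ℝ) ^ N *
      Real.exp (-(γ₀ / (12 * (γ₀ + 1)) * (min ε (ε ^ 2) / (γ * k) * Z))) := by
    intro i
    refine (card_tail_le hk W hB hW0 (fun l j => phaseLoad_le A s₀ σ T hγp.le l.2 j)
      (M := X / k) (by gcongr) hε i).trans ?_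
    refine mul_le_mul_of_nonneg_left (Real.exp_le_exp.2 (neg_le_neg ?_)) (by positivity)
    exact exponent_le hγ₀ hγ hk hε hεk hN1 hZ0 hXZ
      (phaseCount_sub_one_rpow_le A s₀ σ T hγp) hE
  have hfac : (0 : ℝ) < ((k.factorial : ℕ) : ℝ) ^ N := by positivity
  set S := univ.biUnion bad
  have hS : (#S : ℝ) ≤ k * (((k.factorial : ℕ) : ℝ) ^ N *
      Real.exp (-(γ₀ / (12 * (γ₀ + 1)) * (min ε (ε ^ 2) / (γ * k) * Z)))) := by
    calc (#S : ℝ) ≤ ∑ i, (#(bad i) : ℝ) := by exact_mod_cast card_biUnion_le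
      _ ≤ ∑ _i : Fin k, _ := sum_le_sum fun i _ => hcard i
      _ = _ := by simp
  have hsub : {ω | (fun l : Fin N => π (l + 1) ω) ∈ Sᶜ} ⊆
      {ω | ∀ i, phasedCost A γ s₀ σ T (fun l => π l ω) i ≤
        (1 + ε) * (X / k) + 7 * (Z * A.diam s₀ σ T)} := by
    intro ω hω i
    refine hgood ω i (not_lt.1 fun hlt => ?_)
    simp only [Set.mem_ofPred_eq, mem_compl] at hω
    refine hω (mem_biUnion.2 ⟨i, mem_univ i, ?_⟩)
    rw [hbad, mem_filter]
    refine ⟨mem_univ _, hlt.trans_eq (sum_congr rfl fun l _ => ?_)⟩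
    rw [← rolePerm_eq_partialProd (fun l => π l ω) l.succ, Fin.val_succ]
  refine le_trans ?_ (measureReal_mono hsub)
  rw [hπ.prob_tuple_mem, le_div_iff₀ hfac, card_compl, Nat.cast_sub (card_le_univ _)]
  simp only [Fintype.card_pi, Fintype.card_perm, Fintype.card_fin, prod_const, card_univ,
    Nat.cast_pow]
  linarith

end KServer

theorem theorem4p1 :
    ∃ C : ℝ, 0 < C ∧ ∀ γ₀ : ℝ, 0 < γ₀ → ∃ c : ℝ, 0 < c ∧
      ∀ (γ : ℝ), γ₀ ≤ γ → ∀ (k : ℕ), 0 < k →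
      ∀ (M : Type*) [MetricSpace M] (A : KServer.OnlineAlgorithm k M) (s₀ : Fin k → M)
        (σ : ℕ → M) (T : ℕ),
      (1 ≤ A.cost s₀ σ T ∨ ∀ i j, s₀ i = s₀ j) →
      ∀ (Ω : Type*) [MeasurableSpace Ω] (P : Measure Ω) [IsProbabilityMeasure P]
        (π : ℕ → Ω → Equiv.Perm (Fin k)), KServer.IsUniformPermSeq P π →
      (∀ ε : ℝ, 0 < ε →
        1 - (k : ℝ) * Real.exp
            (-(c * (min ε (ε ^ 2) / (γ * k) * A.cost s₀ σ T ^ (1 / (γ + 1))))) ≤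
          P.real {ω | ∀ i, KServer.phasedCost A γ s₀ σ T (fun l => π l ω) i ≤
            (1 + ε) * (A.cost s₀ σ T / k) +
              C * (A.cost s₀ σ T ^ (1 / (γ + 1)) * A.diam s₀ σ T)}) ∧
      (∀ ω, ∑ i, KServer.phasedCost A γ s₀ σ T (fun l => π l ω) i ≤
        A.cost s₀ σ T + C * (A.cost s₀ σ T ^ (1 / (γ + 1)) * k * A.diam s₀ σ T)) := by
  -- `7 = 1 + 2 * 3`: the initial swap, and `3 * diam` for each of at most `2 * cost ^ (1 / (γ +
  -- 1))` ended phases. `12 = 4 * 3`: the Chernoff constant times the one in `add_one_rpow_le`.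
  refine ⟨7, by norm_num, fun γ₀ hγ₀ => ⟨γ₀ / (12 * (γ₀ + 1)), by positivity, ?_⟩⟩
  intro γ hγ k hk M _ A s₀ σ T h Ω _ P _ π hπ
  exact ⟨fun ε hε => KServer.prob_phasedCost_le hγ₀ hγ hε hk A s₀ σ T h hπ,
    fun ω => KServer.sum_phasedCost_le A s₀ σ T (hγ₀.trans_le hγ) h fun l => π l ω⟩
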